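/- Let $q$ be a complex number with $0<|q|<1$. Put $(q)_m=\prod_{k=1}^{m}(1-q^k)$ for $m\in\mathbb{N}\cup\{\infty\}$, and use the convention $1/(q)_m=0$ for integers $m<0$. For every integer $n>2$ and all integers $c_1,\dots,c_{n-1}$, $$ \sum_{a \geq 0} (-1)^{na}\, \frac{q^{\frac{na(a+1)}{2} -a + a \sum_{k=1}^{n-1} c_{k}}}{(q)_{a}\prod_{k=1}^{n-1}(q)_{a+c_{k}}} = \frac{1}{(q)_{\infty}} \sum_{i_{1}, \dots, i_{n-2} \geq 0} (-1)^{\sum_{k=1}^{n-2}\sum_{j=1}^{k}i_{j}}\, \frac{q^{\frac{1}{2}\sum_{k=1}^{n-2}\bigl(\sum_{j=1}^{k}i_{j}\bigr)\bigl(1+\sum_{j=1}^{k}i_{j} \bigr)+ \sum_{k=2}^{n-1}\sum_{j=1}^{k-1}c_{k}i_{j}}}{\prod_{k=1}^{n-2}(q)_{i_{k}}\,\prod_{k=1}^{n-2} (q)_{c_{k} +\sum_{j=1}^{k}i_{j} }}, $$ where both series converge absolutely. -/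

import Mathlib

noncomputable section

/-- The finite `q`-Pochhammer symbol `(a; q)_n = ∏_{k=1}^{n} (1 - a q^{k-1})`. -/
def qPoch (a q : ℂ) (n : ℕ) : ℂ :=
  ∏ k ∈ Finset.range n, (1 - a * q ^ k)

/-- The infinite `q`-Pochhammer symbol `(a; q)_∞ = ∏_{k ≥ 1} (1 - a q^{k-1})`. -/
def qPochInf (a q : ℂ) : ℂ :=
  ∏' k : ℕ, (1 - a * q ^ k)

/-- The reciprocal `1 / (q)_m` with `(q)_m = (q; q)_m`, for an integer `m`, with the convention
that it is `0` for `m < 0`. -/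
def qRecip (q : ℂ) (m : ℤ) : ℂ :=
  if m < 0 then 0 else 1 / qPoch q q m.toNat

/-- The partial sum `i_1 + ⋯ + i_k` of a tuple `(i_1, …, i_m)`; the entry `i_j` is
stored at the position `j - 1` of `Fin m`. -/
def partSum {m : ℕ} (i : Fin m → ℕ) (k : ℕ) : ℕ :=
  ∑ j ∈ Finset.univ.filter (fun j : Fin m => (j : ℕ) < k), i j

/-- The term of index `a` of the single sum. Here `c k` stands for `c_k`, `1 ≤ k ≤ n - 1`.
The division by `2` in the exponent is exact. -/
def singleTerm (q : ℂ) (n : ℕ) (c : ℕ → ℤ) (a : ℕ) : ℂ :=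
  (-1) ^ (n * a) *
    q ^ ((n * a * (a + 1) : ℤ) / 2 - a + a * ∑ k ∈ Finset.Icc 1 (n - 1), c k) *
    (qRecip q a * ∏ k ∈ Finset.Icc 1 (n - 1), qRecip q (a + c k))

/-- The term of index `(i_1, …, i_{n-2})` of the multiple sum.
The division by `2` in the exponent is exact. -/
def multiTerm (q : ℂ) (n : ℕ) (c : ℕ → ℤ) (i : Fin (n - 2) → ℕ) : ℂ :=
  (-1) ^ (∑ k ∈ Finset.Icc 1 (n - 2), partSum i k) *
    q ^ ((∑ k ∈ Finset.Icc 1 (n - 2), (partSum i k : ℤ) * (1 + partSum i k)) / 2 +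
      ∑ k ∈ Finset.Icc 2 (n - 1), c k * (partSum i (k - 1) : ℤ)) *
    ((∏ k : Fin (n - 2), qRecip q (i k)) *
      ∏ k ∈ Finset.Icc 1 (n - 2), qRecip q (c k + partSum i k))

end

open Filter Topology Finset

lemma one_sub_pow_succ_ne_zero {q : ℂ} (hq1 : ‖q‖ < 1) (k : ℕ) : 1 - q * q ^ k ≠ 0 := by
  intro h
  have h1 : ‖q ^ (k + 1)‖ = 1 := by
    rw [pow_succ', ← sub_eq_zero.mp h, norm_one]
  rw [norm_pow] at h1
  exact (pow_lt_one₀ (norm_nonneg q) hq1 k.succ_ne_zero).ne h1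

lemma qPoch_self_ne_zero {q : ℂ} (hq1 : ‖q‖ < 1) (n : ℕ) : qPoch q q n ≠ 0 :=
  Finset.prod_ne_zero_iff.mpr fun k _ => one_sub_pow_succ_ne_zero hq1 k

lemma summable_norm_neg_mul_pow {q : ℂ} (hq1 : ‖q‖ < 1) :
    Summable fun k : ℕ => ‖-(q * q ^ k)‖ := by
  simpa using (summable_geometric_of_lt_one (norm_nonneg q) hq1).mul_left ‖q‖

lemma qPochInf_self_ne_zero {q : ℂ} (hq1 : ‖q‖ < 1) : qPochInf q q ≠ 0 := by
  have h := tprod_one_add_ne_zero_of_summable (f := fun k : ℕ => -(q * q ^ k))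
    (fun k => by simpa [sub_eq_add_neg] using one_sub_pow_succ_ne_zero hq1 k)
    (summable_norm_neg_mul_pow hq1)
  simpa [qPochInf, sub_eq_add_neg] using h

lemma tendsto_qPoch_self {q : ℂ} (hq1 : ‖q‖ < 1) :
    Tendsto (qPoch q q) atTop (𝓝 (qPochInf q q)) := by
  have h := (multipliable_one_add_of_summable
    (summable_norm_neg_mul_pow hq1)).tendsto_prod_tprod_nat
  simpa [qPochInf, qPoch, sub_eq_add_neg, funext_iff] using! h

lemma qRecip_natCast (q : ℂ) (m : ℕ) : qRecip q m = 1 / qPoch q q m := by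
  simp [qRecip]

lemma qRecip_of_neg (q : ℂ) {m : ℤ} (hm : m < 0) : qRecip q m = 0 := by
  simp [qRecip, hm]

@[simp] lemma qRecip_zero (q : ℂ) : qRecip q 0 = 1 := by
  simp [qRecip, qPoch]

lemma tendsto_qRecip {q : ℂ} (hq1 : ‖q‖ < 1) :
    Tendsto (fun m : ℕ => qRecip q m) atTop (𝓝 (1 / qPochInf q q)) := by
  simp only [qRecip_natCast, one_div]
  exact (tendsto_qPoch_self hq1).inv₀ (qPochInf_self_ne_zero hq1)

/-- The recurrence `1 / (q)_{m-1} = (1 - q^m) / (q)_m`, valid for every integer `m`. -/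
lemma qRecip_sub_one {q : ℂ} (hq1 : ‖q‖ < 1) (m : ℤ) :
    qRecip q (m - 1) = (1 - q ^ m) * qRecip q m := by
  rcases lt_trichotomy m 0 with hm | rfl | hm
  · rw [qRecip_of_neg q hm, qRecip_of_neg q (by omega), mul_zero]
  · rw [qRecip_of_neg q (by omega)]; simp
  · obtain ⟨k, rfl⟩ : ∃ k : ℕ, m = (k + 1 : ℕ) := ⟨(m - 1).toNat, by omega⟩
    rw [show ((k + 1 : ℕ) : ℤ) - 1 = (k : ℕ) by push_cast; ring, qRecip_natCast, qRecip_natCast,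
      zpow_natCast]
    have h1 := qPoch_self_ne_zero hq1 k
    have h2 := one_sub_pow_succ_ne_zero hq1 k
    have h3 : qPoch q q (k + 1) = qPoch q q k * (1 - q * q ^ k) := by
      simp [qPoch, Finset.prod_range_succ]
    rw [h3, pow_succ']
    field_simp

lemma exists_norm_qRecip_le {q : ℂ} (hq1 : ‖q‖ < 1) :
    ∃ C : ℝ, 0 ≤ C ∧ ∀ m : ℤ, ‖qRecip q m‖ ≤ C := by
  obtain ⟨C, hC⟩ := (tendsto_qRecip hq1).norm.bddAbove_range
  have hC' : ∀ m : ℕ, ‖qRecip q m‖ ≤ C := fun m => hC ⟨m, rfl⟩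
  have h0 : 0 ≤ C := (norm_nonneg _).trans (hC' 0)
  refine ⟨C, h0, fun m => ?_⟩
  rcases lt_or_ge m 0 with hm | hm
  · simpa [qRecip_of_neg q hm] using h0
  · lift m to ℕ using hm
    exact hC' m

/-- The triangular number `s (s + 1) / 2`, as an integer. -/
def triNum (s : ℕ) : ℤ := (s * (s + 1) : ℤ) / 2

lemma two_mul_triNum (s : ℕ) : 2 * triNum s = s * (s + 1) :=
  Int.mul_ediv_cancel' (Int.even_mul_succ_self s).two_dvd

lemma triNum_add (s t : ℕ) : triNum (s + t) = triNum s + triNum t + s * t := by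
  have h1 := two_mul_triNum (s + t)
  have h2 := two_mul_triNum s
  have h3 := two_mul_triNum t
  push_cast at h1
  linarith

@[simp] lemma triNum_zero : triNum 0 = 0 := rfl

@[simp] lemma triNum_one : triNum 1 = 1 := rfl

lemma le_triNum (s : ℕ) : (s : ℤ) ≤ triNum s := by
  have h1 := two_mul_triNum s
  rcases Nat.eq_zero_or_pos s with rfl | h
  · simp
  · have : (1 : ℤ) ≤ s := by exact_mod_cast h
    nlinarith

lemma sub_sq_le_triNum_add_mul (s : ℕ) (c : ℤ) : (s : ℤ) - c ^ 2 ≤ triNum s + s * c := by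
  have h1 := two_mul_triNum s
  have h2 : (0 : ℤ) ≤ (s + c) * (s + c - 1) := by
    rcases le_or_gt ((s : ℤ) + c) 0 with h | h
    · exact mul_nonneg_of_nonpos_of_nonpos h (by omega)
    · exact mul_nonneg h.le (by omega)
  have h3 : (0 : ℤ) ≤ c * (c + 1) := by
    rcases le_or_gt 0 c with h | h
    · exact mul_nonneg h (by omega)
    · exact mul_nonneg_of_nonpos_of_nonpos h.le (by omega)
  nlinarith

lemma norm_zpow_triNum_add_mul_le {q : ℂ} (hq0 : q ≠ 0) (hq1 : ‖q‖ < 1) (s : ℕ) (c : ℤ) :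
    ‖q ^ (triNum s + s * c)‖ ≤ ‖q‖ ^ (-c ^ 2) * ‖q‖ ^ s := by
  have h0 : 0 < ‖q‖ := norm_pos_iff.mpr hq0
  rw [norm_zpow, ← zpow_natCast ‖q‖ s, ← zpow_add₀ h0.ne']
  exact zpow_le_zpow_right_of_le_one₀ h0 hq1.le (by linarith [sub_sq_le_triNum_add_mul s c])

/-- Terminating `q`-Chu–Vandermonde summation in the form used here. -/
lemma sum_antidiagonal_qRecip {q : ℂ} (hq0 : q ≠ 0) (hq1 : ‖q‖ < 1) (b : ℕ) (m : ℤ) :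
    ∑ p ∈ antidiagonal b, (-1) ^ p.2 * q ^ (triNum p.2 - p.2) * qRecip q p.2 * qRecip q p.1 *
      qRecip q (m - p.2) = q ^ (b * m) * qRecip q m * qRecip q b := by
  induction b generalizing m with
  | zero => simp
  | succ b ih =>
    have hb : (1 - q ^ ((b : ℤ) + 1)) ≠ 0 := by
      have := one_sub_pow_succ_ne_zero hq1 b
      rwa [← pow_succ', ← zpow_natCast, Nat.cast_succ] at this
    have hrec : ∀ k : ℕ, (1 - q ^ ((k : ℤ) + 1)) * qRecip q (k + 1) = qRecip q k := fun k => by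
      rw [← qRecip_sub_one hq1, add_sub_cancel_right]
    apply mul_left_cancel₀ hb
    have hsplit : ∀ p ∈ antidiagonal (b + 1),
        (1 - q ^ ((b : ℤ) + 1)) * ((-1) ^ p.2 * q ^ (triNum p.2 - p.2) * qRecip q p.2 *
          qRecip q p.1 * qRecip q (m - p.2)) =
        (-1) ^ p.2 * q ^ (triNum p.2 - p.2) * qRecip q p.2 *
          ((1 - q ^ (p.1 : ℤ)) * qRecip q p.1) * qRecip q (m - p.2) +
        (-1) ^ p.2 * q ^ (triNum p.2 - p.2) * ((1 - q ^ (p.2 : ℤ)) * qRecip q p.2) *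
          (q ^ (p.1 : ℤ) * qRecip q p.1) * qRecip q (m - p.2) := by
      intro p hp
      have hp' : ((p.1 : ℤ) + p.2) = b + 1 := by exact_mod_cast mem_antidiagonal.mp hp
      rw [← hp', zpow_add₀ hq0]
      ring
    rw [mul_sum, sum_congr rfl hsplit, sum_add_distrib, Nat.sum_antidiagonal_succ,
      Nat.sum_antidiagonal_succ']
    have hA : ∑ p ∈ antidiagonal b, (-1) ^ p.2 * q ^ (triNum p.2 - p.2) * qRecip q p.2 *
        ((1 - q ^ (((p.1 + 1 : ℕ)) : ℤ)) * qRecip q ((p.1 + 1 : ℕ))) * qRecip q (m - p.2) =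
        q ^ (b * m) * qRecip q m * qRecip q b := by
      rw [← ih m]
      refine sum_congr rfl fun p _ => ?_
      rw [Nat.cast_succ, hrec]
    have hB : ∑ p ∈ antidiagonal b, (-1) ^ (p.2 + 1) * q ^ (triNum (p.2 + 1) - (p.2 + 1 : ℕ)) *
        ((1 - q ^ (((p.2 + 1 : ℕ)) : ℤ)) * qRecip q ((p.2 + 1 : ℕ))) *
          (q ^ (p.1 : ℤ) * qRecip q p.1) * qRecip q (m - (p.2 + 1 : ℕ)) =
        -(q ^ (b : ℤ) * (q ^ (b * (m - 1)) * qRecip q (m - 1) * qRecip q b)) := by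
      rw [← ih (m - 1), mul_sum, ← sum_neg_distrib]
      refine sum_congr rfl fun p hp => ?_
      have hp' : ((p.1 : ℤ) + p.2) = b := by exact_mod_cast mem_antidiagonal.mp hp
      rw [Nat.cast_succ, hrec, triNum_add, ← hp',
        show triNum p.2 + triNum 1 + (p.2 : ℤ) * ((1 : ℕ) : ℤ) - ((p.2 : ℤ) + 1) =
          (triNum p.2 - p.2) + p.2 by simp; ring, zpow_add₀ hq0, zpow_add₀ hq0 p.1,
        show m - 1 - (p.2 : ℤ) = m - (p.2 + 1) by ring]
      ring
    rw [hA, hB, qRecip_sub_one hq1 m, Nat.cast_succ, ← hrec b]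
    simp only [Nat.cast_zero, zpow_zero, sub_self, zero_mul, mul_zero, zero_add]
    have e1 : q ^ (((b : ℤ) + 1) * m) = q ^ ((b : ℤ) * m) * q ^ m := by
      rw [← zpow_add₀ hq0]; ring_nf
    have e2 : q ^ (b : ℤ) * q ^ ((b : ℤ) * (m - 1)) = q ^ ((b : ℤ) * m) := by
      rw [← zpow_add₀ hq0]; ring_nf
    rw [e1]
    linear_combination (-(1 - q ^ m) * qRecip q m * ((1 - q ^ ((b : ℤ) + 1)) * qRecip q (b + 1))) * e2

/-- The term of Cauchy's series `∑ q^{a^2 + a c} / ((q)_a (q)_{a+c})`. -/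
noncomputable def cauchyTerm (q : ℂ) (c : ℤ) (a : ℕ) : ℂ :=
  q ^ ((a : ℤ) ^ 2 + a * c) * qRecip q a * qRecip q (a + c)

lemma norm_zpow_triNum_sub_le_one {q : ℂ} (hq0 : q ≠ 0) (hq1 : ‖q‖ < 1) (a : ℕ) :
    ‖q ^ (triNum a - a)‖ ≤ 1 := by
  rw [norm_zpow]
  exact zpow_le_one₀ (norm_pos_iff.mpr hq0) hq1.le (by linarith [le_triNum a])

lemma summable_cauchyTerm {q : ℂ} (hq0 : q ≠ 0) (hq1 : ‖q‖ < 1) (c : ℤ) :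
    Summable (cauchyTerm q c) := by
  obtain ⟨C, hC0, hC⟩ := exists_norm_qRecip_le hq1
  refine Summable.of_norm_bounded (g := fun a : ℕ => 1 * (‖q‖ ^ (-c ^ 2) * ‖q‖ ^ a) * C * C)
    ?_ fun a => ?_
  · simp only [one_mul]
    exact ((((summable_geometric_of_lt_one (norm_nonneg q) hq1).mul_left _).mul_right _).mul_right _)
  · have e : (a : ℤ) ^ 2 + a * c = (triNum a - a) + (triNum a + a * c) := by
      linarith [two_mul_triNum a]
    rw [cauchyTerm, e, zpow_add₀ hq0, norm_mul, norm_mul, norm_mul]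
    gcongr
    · exact norm_zpow_triNum_sub_le_one hq0 hq1 a
    · exact norm_zpow_triNum_add_mul_le hq0 hq1 a c
    · exact hC _
    · exact hC _

lemma tendsto_tsum_cauchyTerm {q : ℂ} (hq0 : q ≠ 0) (hq1 : ‖q‖ < 1) :
    Tendsto (fun N : ℕ => ∑' a, cauchyTerm q N a) atTop (𝓝 (1 / qPochInf q q)) := by
  obtain ⟨C, hC0, hC⟩ := exists_norm_qRecip_le hq1
  have hbound : ∀ N a k : ℕ, k ≤ a ^ 2 + a * N → ‖cauchyTerm q N a‖ ≤ ‖q‖ ^ k * C * C := by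
    intro N a k hk
    rw [cauchyTerm, norm_mul, norm_mul]
    gcongr
    · rw [show (a : ℤ) ^ 2 + a * (N : ℤ) = ((a ^ 2 + a * N : ℕ) : ℤ) by push_cast; ring,
        zpow_natCast, norm_pow]
      exact pow_le_pow_of_le_one (norm_nonneg q) hq1.le hk
    · exact hC _
    · exact hC _
  have hlim : ∑' a : ℕ, (if a = 0 then 1 / qPochInf q q else 0) = 1 / qPochInf q q := by
    rw [tsum_ite_eq]
  rw [← hlim]
  refine tendsto_tsum_of_dominated_convergence (bound := fun a : ℕ => ‖q‖ ^ a * C * C) ?_ ?_ ?_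
  · exact ((summable_geometric_of_lt_one (norm_nonneg q) hq1).mul_right _).mul_right _
  · intro a
    rcases Nat.eq_zero_or_pos a with rfl | ha
    · simpa [cauchyTerm] using! tendsto_qRecip hq1
    · rw [if_neg ha.ne']
      have hz : Tendsto (fun N : ℕ => ‖q‖ ^ N * C * C) atTop (𝓝 0) := by
        simpa using ((tendsto_pow_atTop_nhds_zero_of_lt_one (norm_nonneg q) hq1).mul_const C).mul_const C
      refine squeeze_zero_norm (fun N => ?_) hz
      exact hbound N a N (by nlinarith)
  · refine Eventually.of_forall fun N a => ?_
    exact hbound N a a (by nlinarith)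

lemma tsum_cauchyTerm_sub {q : ℂ} (hq0 : q ≠ 0) (hq1 : ‖q‖ < 1) (c : ℤ) :
    ∑' a, cauchyTerm q c a - ∑' a, cauchyTerm q (c + 1) a =
      -q ^ (c + 1) * (∑' a, cauchyTerm q (c + 1) a - ∑' a, cauchyTerm q (c + 1 + 1) a) := by
  have h0 := summable_cauchyTerm hq0 hq1 c
  have h1 := summable_cauchyTerm hq0 hq1 (c + 1)
  have hu : Summable fun a =>
      cauchyTerm q c a - cauchyTerm q (c + 1) a + q ^ (c + 1) * cauchyTerm q (c + 1) a :=
    (h0.sub h1).add (h1.mul_left _)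
  have hu' : ∀ a : ℕ, cauchyTerm q c a - cauchyTerm q (c + 1) a +
      q ^ (c + 1) * cauchyTerm q (c + 1) a =
      q ^ ((a : ℤ) ^ 2 + a * c) * qRecip q (a - 1) * qRecip q (a + (c + 1)) := by
    intro a
    have hr : qRecip q (a + c) = (1 - q ^ ((a : ℤ) + (c + 1))) * qRecip q (a + (c + 1)) := by
      rw [← qRecip_sub_one hq1]; ring_nf
    have e : q ^ ((a : ℤ) ^ 2 + a * (c + 1)) = q ^ ((a : ℤ) ^ 2 + a * c) * q ^ (a : ℤ) := by
      rw [← zpow_add₀ hq0]; ring_nf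
    rw [cauchyTerm, cauchyTerm, hr, qRecip_sub_one hq1, e, zpow_add₀ hq0 (a : ℤ)]
    ring
  have hsucc : ∀ a : ℕ, q ^ (((a + 1 : ℕ) : ℤ) ^ 2 + (a + 1 : ℕ) * c) *
      qRecip q ((a + 1 : ℕ) - 1) * qRecip q ((a + 1 : ℕ) + (c + 1)) =
      q ^ (c + 1) * cauchyTerm q (c + 1 + 1) a := by
    intro a
    rw [cauchyTerm, ← mul_assoc, ← mul_assoc, ← zpow_add₀ hq0]
    push_cast
    ring_nf
  have key := hu.tsum_eq_zero_add
  simp only [hu', hsucc, tsum_mul_left] at key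
  rw [← tsum_congr hu', (h0.sub h1).tsum_add (h1.mul_left _), h0.tsum_sub h1, tsum_mul_left,
    qRecip_of_neg q (by norm_num : ((0 : ℕ) : ℤ) - 1 < 0)] at key
  linear_combination key

/-- Cauchy's identity `∑ q^{a^2 + a c} / ((q)_a (q)_{a+c}) = 1 / (q)_∞`. -/
lemma tsum_cauchyTerm {q : ℂ} (hq0 : q ≠ 0) (hq1 : ‖q‖ < 1) (c : ℤ) :
    ∑' a, cauchyTerm q c a = 1 / qPochInf q q := by
  set f : ℤ → ℂ := fun c => ∑' a, cauchyTerm q c a with hf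
  have hlim : Tendsto (fun N : ℕ => f N) atTop (𝓝 (1 / qPochInf q q)) :=
    tendsto_tsum_cauchyTerm hq0 hq1
  have hrec : ∀ c, f c - f (c + 1) = -q ^ (c + 1) * (f (c + 1) - f (c + 1 + 1)) :=
    tsum_cauchyTerm_sub hq0 hq1
  have hnat : ∀ N : ℕ, f N - f (N + 1) = 0 := by
    have hmono : Monotone fun N : ℕ => ‖f N - f (N + 1)‖ := by
      refine monotone_nat_of_le_succ fun N => ?_
      rw [hrec N, norm_mul, norm_neg, norm_zpow, Nat.cast_succ]
      exact mul_le_of_le_one_left (norm_nonneg _)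
        (zpow_le_one₀ (norm_pos_iff.mpr hq0) hq1.le (by positivity))
    have hz : Tendsto (fun N : ℕ => ‖f N - f (N + 1)‖) atTop (𝓝 0) := by
      have h := (hlim.sub (hlim.comp (tendsto_add_atTop_nat 1))).norm
      simpa using! h
    intro N
    exact norm_le_zero_iff.mp (hmono.ge_of_tendsto hz N)
  have hint : ∀ c, f c = f (c + 1) := by
    have hdown : ∀ (N : ℕ) (c : ℤ), 0 ≤ c + N → f c - f (c + 1) = 0 := by
      intro N
      induction N with
      | zero =>
        intro c hc
        lift c to ℕ using by simpa using hc
        exact hnat c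
      | succ N ih =>
        intro c hc
        rw [hrec, ih (c + 1) (by push_cast at hc; linarith), mul_zero]
    exact fun c => sub_eq_zero.mp (hdown c.natAbs c (by omega))
  have hshift : ∀ (c : ℤ) (N : ℕ), f (c + N) = f c := by
    intro c N
    induction N with
    | zero => simp
    | succ N ih => rw [← ih, hint (c + N), Nat.cast_succ, add_assoc]
  have hzero : ∀ N : ℕ, f N = f 0 := fun N => by simpa using hshift 0 N
  have h1 : f 0 = 1 / qPochInf q q := by
    refine tendsto_nhds_unique ?_ hlim
    simp only [hzero]
    exact tendsto_const_nhds
  have h2 : f c = f 0 := by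
    rw [← hshift c c.natAbs, ← hzero (c + c.natAbs).toNat, Int.toNat_of_nonneg (by omega)]
  exact h2.trans h1

/-- The factor `(-1)^s q^{s(s+1)/2 + s c} / (q)_{s + c}`. -/
noncomputable def signedFactor (q : ℂ) (s : ℕ) (c : ℤ) : ℂ :=
  (-1) ^ s * q ^ (triNum s + s * c) * qRecip q (s + c)

@[to_additive]
lemma prod_Icc_eq_prod_range_add {M : Type*} [CommMonoid M] (f : ℕ → M) {r N s : ℕ}
    (h : N + 1 = s + r) : ∏ k ∈ Finset.Icc r N, f k = ∏ k ∈ range s, f (k + r) := by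
  rw [range_eq_Ico, prod_Ico_add', zero_add, ← h]
  rfl

lemma prod_zpow_eq_zpow_sum {q : ℂ} (hq0 : q ≠ 0) (e : ℕ → ℤ) (s : Finset ℕ) :
    ∏ k ∈ s, q ^ e k = q ^ ∑ k ∈ s, e k := by
  induction s using Finset.induction_on with
  | empty => simp
  | insert k s hk ih => rw [prod_insert hk, sum_insert hk, ih, zpow_add₀ hq0]

lemma singleTerm_eq_prod {q : ℂ} (hq0 : q ≠ 0) (m : ℕ) (c : ℕ → ℤ) (a : ℕ) :
    singleTerm q (m + 2) c a = (-1) ^ a * q ^ (triNum a - a) * qRecip q a *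
      ∏ k ∈ range (m + 1), signedFactor q a (c (k + 1)) := by
  have e : (((m + 2 : ℕ) : ℤ) * a * (a + 1)) / 2 = (m + 2) * triNum a := by
    rw [mul_assoc, ← two_mul_triNum a]
    push_cast
    rw [show ((m : ℤ) + 2) * (2 * triNum a) = 2 * ((m + 2) * triNum a) by ring]
    exact Int.mul_ediv_cancel_left _ two_ne_zero
  have hz : ∏ k ∈ range (m + 1), q ^ (triNum a + a * c (k + 1)) =
      q ^ ((m + 1) * triNum a + a * ∑ k ∈ range (m + 1), c (k + 1)) := by
    rw [prod_zpow_eq_zpow_sum hq0, sum_add_distrib, mul_sum]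
    simp
  unfold singleTerm signedFactor
  rw [e, prod_Icc_eq_prod_range_add _ (show m + 2 - 1 + 1 = m + 1 + 1 by omega),
    sum_Icc_eq_sum_range_add _ (show m + 2 - 1 + 1 = m + 1 + 1 by omega),
    prod_mul_distrib, prod_mul_distrib, hz, prod_const, card_range,
    show ((m : ℤ) + 2) * triNum a - a + a * ∑ k ∈ range (m + 1), c (k + 1) =
      (triNum a - a) + ((m + 1) * triNum a + a * ∑ k ∈ range (m + 1), c (k + 1)) by ring,
    zpow_add₀ hq0, ← pow_mul, show (m + 2) * a = a + a * (m + 1) by ring, pow_add]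
  ring

/-- The factor of index `k` of the term of the multiple sum. -/
noncomputable def multiFactor (q : ℂ) {m : ℕ} (c : ℕ → ℤ) (i : Fin m → ℕ) (k : Fin m) : ℂ :=
  (-1) ^ partSum i (k + 1) *
    q ^ (triNum (partSum i (k + 1)) + partSum i (k + 1) * c (k + 2)) *
    qRecip q (i k) * qRecip q (c (k + 1) + partSum i (k + 1))

lemma multiTerm_eq_prod {q : ℂ} (hq0 : q ≠ 0) (m : ℕ) (c : ℕ → ℤ) (i : Fin m → ℕ) :
    multiTerm q (m + 2) c i = ∏ k, multiFactor q c i k := by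
  have e : (∑ k ∈ range m, (partSum i (k + 1) : ℤ) * (1 + partSum i (k + 1))) / 2 =
      ∑ k ∈ range m, triNum (partSum i (k + 1)) := by
    have h : ∀ k ∈ range m, (partSum i (k + 1) : ℤ) * (1 + partSum i (k + 1)) =
        2 * triNum (partSum i (k + 1)) := fun k _ => by rw [two_mul_triNum, add_comm 1]
    rw [sum_congr rfl h, ← mul_sum]
    exact Int.mul_ediv_cancel_left _ two_ne_zero
  have hz : ∏ k ∈ range m, q ^ (triNum (partSum i (k + 1)) + partSum i (k + 1) * c (k + 2)) =
      q ^ (∑ k ∈ range m, triNum (partSum i (k + 1)) +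
        ∑ k ∈ range m, c (k + 2) * partSum i (k + 1)) := by
    rw [prod_zpow_eq_zpow_sum hq0, sum_add_distrib]
    simp only [mul_comm]
  unfold multiTerm multiFactor
  simp only [sum_Icc_eq_sum_range_add _ (show m + 2 - 2 + 1 = m + 1 by omega),
    prod_Icc_eq_prod_range_add _ (show m + 2 - 2 + 1 = m + 1 by omega),
    sum_Icc_eq_sum_range_add _ (show m + 2 - 1 + 1 = m + 2 by omega)]
  simp only [prod_mul_distrib]
  rw [Fin.prod_univ_eq_prod_range (fun k => (-1 : ℂ) ^ partSum i (k + 1)) m,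
    Fin.prod_univ_eq_prod_range
      (fun k => q ^ (triNum (partSum i (k + 1)) + partSum i (k + 1) * c (k + 2))) m,
    Fin.prod_univ_eq_prod_range (fun k => qRecip q (c (k + 1) + partSum i (k + 1))) m,
    hz, ← e, prod_pow_eq_pow_sum, mul_assoc _ (∏ k : Fin m, qRecip q (i k))]
  rfl

lemma partSum_cons_succ {m : ℕ} (x : ℕ) (t : Fin m → ℕ) (k : ℕ) :
    partSum (Fin.cons x t : Fin (m + 1) → ℕ) (k + 1) = x + partSum t k := by
  simp only [partSum, sum_filter, Fin.sum_univ_succ]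
  simp

lemma partSum_zero {m : ℕ} (t : Fin m → ℕ) : partSum t 0 = 0 := by
  simp [partSum]

lemma le_partSum_succ {m : ℕ} (i : Fin m → ℕ) (k : Fin m) : i k ≤ partSum i (k + 1) :=
  single_le_sum (f := i) (fun _ _ => Nat.zero_le _) (by simp)

lemma prod_multiFactor_cons {q : ℂ} (hq0 : q ≠ 0) {m : ℕ} (c : ℕ → ℤ) (x : ℕ) (t : Fin m → ℕ) :
    ∏ k, multiFactor q c (Fin.cons x t : Fin (m + 1) → ℕ) k =
      qRecip q x * qRecip q (c 1 + x) *
        (∏ k ∈ range (m + 1), (-1) ^ x * q ^ (triNum x + x * c (k + 2))) *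
        ∏ k, multiFactor q (fun j => c (j + 1) + x) t k := by
  have h : ∀ k : Fin m, multiFactor q c (Fin.cons x t : Fin (m + 1) → ℕ) k.succ =
      ((-1) ^ x * q ^ (triNum x + x * c (k + 1 + 2))) *
        multiFactor q (fun j => c (j + 1) + x) t k := by
    intro k
    simp only [multiFactor, Fin.val_succ, partSum_cons_succ, Fin.cons_succ]
    rw [triNum_add, show triNum x + triNum (partSum t (k + 1)) + (x : ℤ) * partSum t (k + 1) +
      ((x + partSum t (k + 1) : ℕ) : ℤ) * c (k + 1 + 2) = (triNum x + x * c (k + 1 + 2)) +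
      (triNum (partSum t (k + 1)) + partSum t (k + 1) * (c (k + 2 + 1) + x)) by push_cast; ring_nf,
      zpow_add₀ hq0, pow_add]
    push_cast
    rw [← add_assoc (c _) (x : ℤ)]
    ring
  rw [Fin.prod_univ_succ, prod_congr rfl fun k _ => h k, prod_mul_distrib, prod_range_succ',
    Fin.prod_univ_eq_prod_range (fun k => (-1 : ℂ) ^ x * q ^ (triNum x + x * c (k + 1 + 2))) m]
  simp only [multiFactor, Fin.val_zero, partSum_cons_succ, partSum_zero, Fin.cons_zero, add_zero]
  simp only [zero_add]
  ring

lemma summable_prod_pow {x : ℝ} (h0 : 0 ≤ x) (h1 : x < 1) (m : ℕ) :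
    Summable fun i : Fin m → ℕ => ∏ k, x ^ i k := by
  induction m with
  | zero => exact Summable.of_finite
  | succ m ih =>
    rw [← (Fin.consEquiv fun _ => ℕ).summable_iff]
    have h := (summable_geometric_of_lt_one h0 h1).mul_of_nonneg ih
      (fun _ => pow_nonneg h0 _) fun _ => prod_nonneg fun _ _ => pow_nonneg h0 _
    simpa [Function.comp_def, Fin.consEquiv, Fin.prod_univ_succ] using! h

lemma norm_multiFactor_le {q : ℂ} (hq0 : q ≠ 0) (hq1 : ‖q‖ < 1) {C : ℝ}
    (hC : ∀ m : ℤ, ‖qRecip q m‖ ≤ C) {m : ℕ} (c : ℕ → ℤ) (i : Fin m → ℕ) (k : Fin m) :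
    ‖multiFactor q c i k‖ ≤ ‖q‖ ^ (-c (k + 2) ^ 2) * C * C * ‖q‖ ^ i k := by
  have hC0 : 0 ≤ C := (norm_nonneg _).trans (hC 0)
  have h1 := (norm_zpow_triNum_add_mul_le hq0 hq1 (partSum i (k + 1)) (c (k + 2))).trans
    (mul_le_mul_of_nonneg_left (pow_le_pow_of_le_one (norm_nonneg q) hq1.le (le_partSum_succ i k))
      (zpow_nonneg (norm_nonneg q) _))
  have h2 := mul_le_mul (mul_le_mul h1 (hC (i k)) (norm_nonneg _) (by positivity))
    (hC (c (k + 1) + partSum i (k + 1))) (norm_nonneg _) (by positivity)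
  rw [multiFactor, norm_mul, norm_mul, norm_mul, norm_pow, norm_neg, norm_one, one_pow, one_mul]
  refine h2.trans_eq ?_
  rw [mul_right_comm _ (‖q‖ ^ i k) C, mul_right_comm _ (‖q‖ ^ i k) C]

lemma summable_prod_multiFactor {q : ℂ} (hq0 : q ≠ 0) (hq1 : ‖q‖ < 1) (m : ℕ) (c : ℕ → ℤ) :
    Summable fun i : Fin m → ℕ => ∏ k, multiFactor q c i k := by
  obtain ⟨C, -, hC⟩ := exists_norm_qRecip_le hq1
  refine Summable.of_norm_bounded
    ((summable_prod_pow (norm_nonneg q) hq1 m).mul_left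
      (∏ k : Fin m, ‖q‖ ^ (-c (k + 2) ^ 2) * C * C)) fun i => ?_
  rw [norm_prod, ← prod_mul_distrib]
  exact prod_le_prod (fun _ _ => norm_nonneg _) fun k _ => norm_multiFactor_le hq0 hq1 hC c i k

lemma exists_norm_prod_signedFactor_le {q : ℂ} (hq0 : q ≠ 0) (hq1 : ‖q‖ < 1) (m : ℕ)
    (c : ℕ → ℤ) :
    ∃ K : ℝ, 0 ≤ K ∧ ∀ s : ℕ, ‖∏ k ∈ range (m + 1), signedFactor q s (c k)‖ ≤ K * ‖q‖ ^ s := by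
  obtain ⟨C, hC0, hC⟩ := exists_norm_qRecip_le hq1
  refine ⟨∏ k ∈ range (m + 1), ‖q‖ ^ (-c k ^ 2) * C, by positivity, fun s => ?_⟩
  have h1 : ∏ k ∈ range (m + 1), ‖signedFactor q s (c k)‖ ≤
      ∏ k ∈ range (m + 1), (‖q‖ ^ (-c k ^ 2) * C) * ‖q‖ ^ s := by
    refine prod_le_prod (fun _ _ => norm_nonneg _) fun k _ => ?_
    rw [signedFactor, norm_mul, norm_mul, norm_pow, norm_neg, norm_one, one_pow, one_mul]
    calc _ ≤ (‖q‖ ^ (-c k ^ 2) * ‖q‖ ^ s) * C := by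
          gcongr
          · exact norm_zpow_triNum_add_mul_le hq0 hq1 _ _
          · exact hC _
      _ = _ := by ring
  rw [norm_prod]
  refine h1.trans ?_
  rw [prod_mul_distrib, prod_const, card_range]
  gcongr
  exact pow_le_of_le_one (by positivity) (pow_le_one₀ (norm_nonneg q) hq1.le) m.succ_ne_zero

lemma summable_singleTerm {q : ℂ} (hq0 : q ≠ 0) (hq1 : ‖q‖ < 1) (m : ℕ) (c : ℕ → ℤ) :
    Summable (singleTerm q (m + 2) c) := by
  obtain ⟨C, hC0, hC⟩ := exists_norm_qRecip_le hq1
  obtain ⟨K, hK0, hK⟩ := exists_norm_prod_signedFactor_le hq0 hq1 m fun k => c (k + 1)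
  refine Summable.of_norm_bounded (g := fun a : ℕ => 1 * C * (K * ‖q‖ ^ a))
    (((summable_geometric_of_lt_one (norm_nonneg q) hq1).mul_left _).mul_left _) fun a => ?_
  rw [singleTerm_eq_prod hq0, norm_mul, norm_mul, norm_mul, norm_pow, norm_neg, norm_one, one_pow,
    one_mul]
  gcongr
  · exact norm_zpow_triNum_sub_le_one hq0 hq1 a
  · exact hC _
  · exact hK a

/-- The term of the double series that interpolates between both sides in the inductive step:
summed over `a` it is a multiple of a shorter single sum, and summed over `x + a = b` it is a term
of the longer one. -/
noncomputable def bridgeTerm (q : ℂ) (m : ℕ) (c : ℕ → ℤ) (p : ℕ × ℕ) : ℂ :=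
  (-1) ^ p.2 * q ^ (triNum p.2 - p.2) * qRecip q p.2 * qRecip q p.1 * qRecip q (c 1 + p.1) *
    ∏ k ∈ range (m + 1), signedFactor q (p.1 + p.2) (c (k + 2))

lemma summable_bridgeTerm {q : ℂ} (hq0 : q ≠ 0) (hq1 : ‖q‖ < 1) (m : ℕ) (c : ℕ → ℤ) :
    Summable (bridgeTerm q m c) := by
  obtain ⟨C, hC0, hC⟩ := exists_norm_qRecip_le hq1
  obtain ⟨K, hK0, hK⟩ := exists_norm_prod_signedFactor_le hq0 hq1 m fun k => c (k + 2)
  have hg := summable_geometric_of_lt_one (norm_nonneg q) hq1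
  refine Summable.of_norm_bounded
    (g := fun p : ℕ × ℕ => 1 * C * C * C * (K * (‖q‖ ^ p.1 * ‖q‖ ^ p.2)))
    (((hg.mul_of_nonneg hg (fun _ => by positivity) fun _ => by positivity).mul_left _).mul_left _)
    fun p => ?_
  rw [bridgeTerm, norm_mul, norm_mul, norm_mul, norm_mul, norm_mul, norm_pow, norm_neg, norm_one,
    one_pow, one_mul, ← pow_add]
  gcongr
  · exact norm_zpow_triNum_sub_le_one hq0 hq1 _
  · exact hC _
  · exact hC _
  · exact hC _
  · exact hK _

lemma bridgeTerm_eq_mul_singleTerm {q : ℂ} (hq0 : q ≠ 0) (m : ℕ) (c : ℕ → ℤ) (x a : ℕ) :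
    bridgeTerm q m c (x, a) = qRecip q x * qRecip q (c 1 + x) *
      (∏ k ∈ range (m + 1), (-1) ^ x * q ^ (triNum x + x * c (k + 2))) *
      singleTerm q (m + 2) (fun j => c (j + 1) + x) a := by
  have h : ∀ k ∈ range (m + 1), signedFactor q (x + a) (c (k + 2)) =
      ((-1) ^ x * q ^ (triNum x + x * c (k + 2))) * signedFactor q a (c (k + 1 + 1) + x) := by
    intro k _
    rw [signedFactor, signedFactor, triNum_add,
      show triNum x + triNum a + (x : ℤ) * a + ((x + a : ℕ) : ℤ) * c (k + 2) =
        (triNum x + x * c (k + 2)) + (triNum a + a * (c (k + 1 + 1) + x)) by push_cast; ring_nf,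
      zpow_add₀ hq0, pow_add, show ((x + a : ℕ) : ℤ) + c (k + 2) = a + (c (k + 1 + 1) + x) by
        push_cast; ring_nf]
    ring
  rw [singleTerm_eq_prod hq0, bridgeTerm, prod_congr rfl h, prod_mul_distrib]
  ring

lemma sum_antidiagonal_bridgeTerm {q : ℂ} (hq0 : q ≠ 0) (hq1 : ‖q‖ < 1) (m : ℕ) (c : ℕ → ℤ)
    (b : ℕ) : ∑ p ∈ antidiagonal b, bridgeTerm q m c p = singleTerm q (m + 1 + 2) c b := by
  have h : ∀ p ∈ antidiagonal b, bridgeTerm q m c p =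
      ((-1) ^ p.2 * q ^ (triNum p.2 - p.2) * qRecip q p.2 * qRecip q p.1 *
        qRecip q ((b + c 1) - p.2)) * ∏ k ∈ range (m + 1), signedFactor q b (c (k + 2)) := by
    intro p hp
    have hp' := mem_antidiagonal.mp hp
    rw [bridgeTerm, hp', show c 1 + (p.1 : ℤ) = b + c 1 - p.2 by rw [← hp']; push_cast; ring]
  rw [sum_congr rfl h, ← sum_mul, sum_antidiagonal_qRecip hq0 hq1, singleTerm_eq_prod hq0,
    prod_range_succ' _ (m + 1), signedFactor.eq_1 q b (c (0 + 1)),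
    show (b : ℤ) * (b + c 1) = (triNum b - b) + (triNum b + b * c (0 + 1)) by
      rw [zero_add]; linarith [two_mul_triNum b], zpow_add₀ hq0]
  have hs : ((-1 : ℂ) ^ b) * (-1) ^ b = 1 := by rw [← mul_pow]; simp
  linear_combination (-(q ^ (triNum b - b) * q ^ (triNum b + b * c (0 + 1)) * qRecip q (b + c 1) *
    qRecip q b * ∏ k ∈ range (m + 1), signedFactor q b (c (k + 2)))) * hs

lemma tsum_eq_tsum_sum_antidiagonal {f : ℕ × ℕ → ℂ} (hf : Summable f) :
    ∑' p, f p = ∑' n, ∑ p ∈ antidiagonal n, f p := by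
  conv_rhs => congr; ext; rw [← Finset.sum_finset_coe, ← tsum_fintype (L := .unconditional _)]
  rw [← HasAntidiagonal.sigmaAntidiagonalEquivProd.tsum_eq f]
  exact (HasAntidiagonal.sigmaAntidiagonalEquivProd.summable_iff.mpr hf).tsum_sigma'
    fun n => (hasSum_fintype _).summable

lemma tsum_singleTerm {q : ℂ} (hq0 : q ≠ 0) (hq1 : ‖q‖ < 1) (m : ℕ) (c : ℕ → ℤ) :
    ∑' a, singleTerm q (m + 2) c a =
      1 / qPochInf q q * ∑' i : Fin m → ℕ, ∏ k, multiFactor q c i k := by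
  induction m generalizing c with
  | zero =>
    rw [← tsum_cauchyTerm hq0 hq1 (c 1)]
    have h : ∀ a, singleTerm q (0 + 2) c a = cauchyTerm q (c 1) a := by
      intro a
      have hs : ((-1 : ℂ) ^ a) * (-1) ^ a = 1 := by rw [← mul_pow]; simp
      rw [singleTerm_eq_prod hq0, cauchyTerm, zero_add, prod_range_one, signedFactor, zero_add,
        show (a : ℤ) ^ 2 + a * c 1 = (triNum a - a) + (triNum a + a * c 1) by
          linarith [two_mul_triNum a], zpow_add₀ hq0 (triNum a - a)]
      linear_combination (q ^ (triNum a - a) * q ^ (triNum a + a * c 1) * qRecip q a *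
        qRecip q (a + c 1)) * hs
    simp [tsum_congr h]
  | succ m ih =>
    have hb := summable_bridgeTerm hq0 hq1 m c
    have hm := (Fin.consEquiv fun _ => ℕ).summable_iff.mpr
      (summable_prod_multiFactor hq0 hq1 (m + 1) c)
    rw [← tsum_congr (sum_antidiagonal_bridgeTerm hq0 hq1 m c),
      ← tsum_eq_tsum_sum_antidiagonal hb, hb.tsum_prod,
      ← (Fin.consEquiv fun _ => ℕ).tsum_eq]
    erw [hm.tsum_prod]
    rw [← tsum_mul_left]
    refine tsum_congr fun x => ?_
    simp only [bridgeTerm_eq_mul_singleTerm hq0, tsum_mul_left, ih, Fin.consEquiv, Equiv.coe_fn_mk,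
      Function.comp_apply, prod_multiFactor_cons hq0]
    ring

theorem mainTheorem2 (q : ℂ) (hq0 : q ≠ 0) (hq1 : ‖q‖ < 1) (n : ℕ) (hn : 2 < n) (c : ℕ → ℤ) :
    Summable (fun a : ℕ => singleTerm q n c a) ∧
    Summable (fun i : Fin (n - 2) → ℕ => multiTerm q n c i) ∧
    ∑' a : ℕ, singleTerm q n c a =
      1 / qPochInf q q * ∑' i : Fin (n - 2) → ℕ, multiTerm q n c i := by
  obtain ⟨m, rfl⟩ : ∃ m, n = m + 2 := ⟨n - 2, by omega⟩
  have hmul : (fun i : Fin m → ℕ => multiTerm q (m + 2) c i) =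
      fun i : Fin m → ℕ => ∏ k, multiFactor q c i k :=
    funext (multiTerm_eq_prod hq0 m c)
  refine ⟨summable_singleTerm hq0 hq1 m c, ?_, ?_⟩
  · change Summable (fun i : Fin m → ℕ => multiTerm q (m + 2) c i)
    rw [hmul]
    exact summable_prod_multiFactor hq0 hq1 m c
  · change _ = _ * tsum (fun i : Fin m → ℕ => multiTerm q (m + 2) c i)
    rw [hmul]
    exact tsum_singleTerm hq0 hq1 m c
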